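/- Let $\mathbb{K}$ be a field, let $V$ be a $\mathbb{K}$-vector space of finite dimension $\ell$, and let $\mathcal{A}$ be a central hyperplane arrangement in $V$, i.e. a finite set of linear hyperplanes of $V$. For $H_0\in\mathcal{A}$ put $\mathcal{A}'=\mathcal{A}\setminus\{H_0\}$, an arrangement in $V$, and $\mathcal{A}''=\{H\cap H_0 \mid H\in\mathcal{A}'\}$, an arrangement in $H_0$. Exponents. Let $S=S(V^*)$, and for $H\in\mathcal{A}$ let $\alpha_H\in V^*$ have kernel $H$. The arrangement $\mathcal{A}$ is free with exponents $\exp\mathcal{A}=\{b_1,\dots,b_\ell\}$ (a multiset) if the $S$-module $D(\mathcal{A})$ of all $\mathbb{K}$-derivations $\theta$ of $S$ with $\theta(\alpha_H)\in\alpha_H S$ for all $H\in\mathcal{A}$ has a basis $\theta_1,\dots,\theta_\ell$ such that $\theta_i$ maps every linear form to a homogeneous polynomial of degree $b_i$. Inductively free arrangements. These form the smallest class of arrangements that contains all empty arrangements and contains $\mathcal{A}$ whenever there is $H_0\in\mathcal{A}$ such that $\mathcal{A}'$ and $\mathcal{A}''$ belong to the class and $\exp\mathcal{A}''\subseteq\exp\mathcal{A}'$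 as multisets. Inductive factorizations. Consider pairs $(\mathcal{A},\pi)$ where $\pi$ is a partition of $\mathcal{A}$ into non-empty blocks. The class of inductively factored pairs is the smallest class that contains every empty arrangement with its empty partition and contains $(\mathcal{A},\pi)$ whenever there are a block of $\pi$, say $\pi_1$, and a hyperplane $H_0\in\pi_1$ such that * the restriction map $\varrho:\mathcal{A}\setminus\pi_1\to\mathcal{A}''$, $H\mapsto H\cap H_0$, is bijective; * $(\mathcal{A}',\pi')$ is in the class, where $\pi'$ consists of the non-empty sets $\pi_i\setminus\{H_0\}$; * $(\mathcal{A}'',\pi'')$ is in the class, where $\pi''$ consists of the sets $\varrho(\pi_i)$, $i\ne 1$. If $(\mathcal{A},\pi)$ is in this class, $\pi$ is called an inductive factorization of $\mathcal{A}$. **Proposition.** Let $\pi=(\pi_1,\dots,\pi_r)$ be an inductive factorization of $\mathcal{A}$. Then $r$ is the rank of $\mathcal{A}$ (the codimension of $\bigcap_{H\in\mathcal{A}}H$ in $V$), and $\mathcal{A}$ is inductively free. Moreover $\mathcal{A}$ is free with $$\exp\mathcal{A}=\{0^{\ell-r},|\pi_1|,\dots,|\pi_r|\},$$ where $0^{\ell-r}$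 means that $0$ is repeated $\ell-r$ times, and this is the only multiset of exponents of $\mathcal{A}$. -/

import Mathlib

universe u v

/-- A (central) hyperplane arrangement in the `K`-vector space `V`: a finite set of linear
hyperplanes, a hyperplane being the kernel of a nonzero linear form. -/
structure Arrangement (K : Type u) (V : Type v) [Field K] [AddCommGroup V] [Module K V] where
  /-- the members of the arrangement -/
  hyperplanes : Finset (Submodule K V)
  exists_eq_ker : ∀ H ∈ hyperplanes, ∃ α : Module.Dual K V, α ≠ 0 ∧ H = LinearMap.ker α

/-- The algebra `S = S(V*)` of polynomial functions on `V`. -/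
abbrev PolyAlg (K : Type u) (V : Type v) [Field K] [AddCommGroup V] [Module K V] : Type (max u v) :=
  SymmetricAlgebra K (Module.Dual K V)

/-- A linear form on `V`, as an element of `S(V*)`. -/
abbrev linForm {K : Type u} {V : Type v} [Field K] [AddCommGroup V] [Module K V]
    (α : Module.Dual K V) : PolyAlg K V :=
  SymmetricAlgebra.ι K (Module.Dual K V) α

/-- The homogeneous component `S_d` of degree `d` of `S = S(V*)`: the span of all products of
`d` linear forms. -/
def homogPart (K : Type u) (V : Type v) [Field K] [AddCommGroup V] [Module K V] (d : ℕ) :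
    Submodule K (PolyAlg K V) :=
  LinearMap.range (SymmetricAlgebra.ι K (Module.Dual K V)) ^ d

/-- A derivation `θ` of `S` is homogeneous of polynomial degree `d` if it maps every linear form
to a homogeneous polynomial of degree `d`. -/
def IsHomogDerivation {K : Type u} {V : Type v} [Field K] [AddCommGroup V] [Module K V]
    (θ : Derivation K (PolyAlg K V) (PolyAlg K V)) (d : ℕ) : Prop :=
  ∀ α : Module.Dual K V, θ (linForm α) ∈ homogPart K V d

namespace Arrangement

section

variable {K : Type u} {V : Type v} [Field K] [AddCommGroup V] [Module K V]

/-- The rank of an arrangement: the codimension of its center `⋂_{H ∈ A} H`. -/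
noncomputable def rank (A : Arrangement K V) : ℕ :=
  Module.finrank K (V ⧸ A.hyperplanes.inf id)

open Classical in
/-- The deletion `A' = A \ {H₀}`. -/
noncomputable def deletion (A : Arrangement K V) (H₀ : Submodule K V) : Arrangement K V where
  hyperplanes := A.hyperplanes \ {H₀}
  exists_eq_ker H hH := A.exists_eq_ker H (Finset.mem_sdiff.mp hH).1

/-- The intersection `H ∩ H₀`, as a subspace of the vector space `H₀`. -/
abbrev restrictTo (H₀ H : Submodule K V) : Submodule K H₀ :=
  H.comap H₀.subtype

open Classical in
/-- The restriction `A'' = {H ∩ H₀ | H ∈ A \ {H₀}}`, an arrangement in the vector space `H₀`,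
for `H₀ ∈ A`. -/
noncomputable def restriction (A : Arrangement K V) (H₀ : Submodule K V)
    (h₀ : H₀ ∈ A.hyperplanes) : Arrangement K H₀ where
  hyperplanes := (A.hyperplanes \ {H₀}).image (restrictTo H₀)
  exists_eq_ker := by
    intro X hX
    obtain ⟨H, hH, rfl⟩ := Finset.mem_image.mp hX
    obtain ⟨hHA, hne⟩ := Finset.mem_sdiff.mp hH
    obtain ⟨α, hα, rfl⟩ := A.exists_eq_ker H hHA
    refine ⟨α.comp H₀.subtype, fun h0 => hne ?_, (LinearMap.ker_comp _ _).symm⟩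
    obtain ⟨β, hβ, rfl⟩ := A.exists_eq_ker H₀ h₀
    have hle : LinearMap.ker β ≤ LinearMap.ker α := fun x hx =>
      LinearMap.congr_fun h0 ⟨x, hx⟩
    obtain ⟨v, hv⟩ : ∃ v, α v ≠ 0 := by
      by_contra! hc
      exact hα (LinearMap.ext hc)
    have hβv : β v ≠ 0 := fun hb => hv (hle hb)
    refine Finset.mem_singleton.mpr (le_antisymm (fun x hx => ?_) hle)
    have hx' : x - (β x / β v) • v ∈ LinearMap.ker β := by
      simp [LinearMap.mem_ker, hβv]
    have h2 : α x - (β x / β v) * α v = 0 := by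
      simpa [LinearMap.mem_ker] using hle hx'
    have hαx : α x = 0 := hx
    have h3 : β x / β v = 0 := by
      rw [hαx, zero_sub, neg_eq_zero] at h2
      exact (mul_eq_zero.mp h2).resolve_right hv
    exact (div_eq_zero_iff.mp h3).resolve_right hβv

/-- The module `D(A)` of logarithmic derivations of `A`: the derivations `θ` of `S` over `K` with
`θ(α_H) ∈ α_H S` for every `H ∈ A`, where `α_H` is a linear form with kernel `H`.  Such a form is
unique up to a nonzero scalar, so that asking this for all of them or for one is the same. -/
def logDer (A : Arrangement K V) :
    Submodule (PolyAlg K V) (Derivation K (PolyAlg K V) (PolyAlg K V)) where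
  carrier := {θ | ∀ H ∈ A.hyperplanes, ∀ α : Module.Dual K V, H = LinearMap.ker α →
    θ (linForm α) ∈ Ideal.span {linForm α}}
  add_mem' h₁ h₂ H hH α hα := Ideal.add_mem _ (h₁ H hH α hα) (h₂ H hH α hα)
  zero_mem' _ _ _ _ := Ideal.zero_mem _
  smul_mem' f _ h H hH α hα := Ideal.mul_mem_left _ f (h H hH α hα)

/-- `A` is free with multiset of exponents `E`: the `S`-module `D(A)` has a basis
`θ_1, …, θ_ℓ` (with `ℓ = dim V`) of homogeneous derivations, and `E` is the multiset of their
polynomial degrees. -/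
def HasExponents (A : Arrangement K V) (E : Multiset ℕ) : Prop :=
  ∃ (b : Module.Basis (Fin (Module.finrank K V)) (PolyAlg K V) A.logDer)
    (d : Fin (Module.finrank K V) → ℕ),
    (∀ i, IsHomogDerivation (b i : Derivation K (PolyAlg K V) (PolyAlg K V)) (d i)) ∧
      E = Finset.univ.val.map d

end

/-- The class of inductively free arrangements: the smallest class that contains all empty
arrangements and contains `A` whenever there is `H₀ ∈ A` such that `A'` and `A''` are in the class
and `exp A'' ⊆ exp A'` (containment of multisets). -/
inductive InductivelyFree {K : Type u} [Field K] :
    ∀ {V : Type v} [AddCommGroup V] [Module K V], Arrangement K V → Prop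
  | empty {V : Type v} [AddCommGroup V] [Module K V] (A : Arrangement K V)
      (hA : A.hyperplanes = ∅) : InductivelyFree A
  | add {V : Type v} [AddCommGroup V] [Module K V] (A : Arrangement K V)
      (H₀ : Submodule K V) (h₀ : H₀ ∈ A.hyperplanes)
      (hdel : InductivelyFree (A.deletion H₀))
      (hres : InductivelyFree (A.restriction H₀ h₀))
      (E' E'' : Multiset ℕ)
      (hE' : (A.deletion H₀).HasExponents E')
      (hE'' : (A.restriction H₀ h₀).HasExponents E'')
      (hle : E'' ≤ E') : InductivelyFree A

open Classical in
/-- The class of pairs `(A, π)` of an arrangement `A` and an inductive factorization `π` of `A`: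
the smallest class of pairs of an arrangement and a partition of it (into nonempty blocks) that
contains the pairs of an empty arrangement and its empty partition, and contains `(A, π)` whenever
there are a block `B` of `π` and a hyperplane `H₀ ∈ B` such that the restriction map
`A \ B → A''`, `H ↦ H ∩ H₀`, is bijective, `(A', π')` is in the class, where `π'` consists of the
nonempty sets among the `C \ {H₀}`, `C ∈ π`, and `(A'', π'')` is in the class, where `π''` consists
of the images under the restriction map of the blocks of `π` other than `B`. -/
inductive InductiveFactorization {K : Type u} [Field K] :
    ∀ {V : Type v} [AddCommGroup V] [Module K V] (A : Arrangement K V),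
      Finpartition A.hyperplanes → Prop
  | empty {V : Type v} [AddCommGroup V] [Module K V] (A : Arrangement K V)
      (hA : A.hyperplanes = ∅) (π : Finpartition A.hyperplanes) : InductiveFactorization A π
  | add {V : Type v} [AddCommGroup V] [Module K V] (A : Arrangement K V)
      (π : Finpartition A.hyperplanes)
      (B : Finset (Submodule K V)) (hB : B ∈ π.parts)
      (H₀ : Submodule K V) (h₀ : H₀ ∈ A.hyperplanes) (hH₀ : H₀ ∈ B)
      (hbij : Set.BijOn (restrictTo H₀) (↑(A.hyperplanes \ B) : Set (Submodule K V))
        (↑(A.restriction H₀ h₀).hyperplanes : Set (Submodule K H₀)))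
      (hdel : InductiveFactorization (A.deletion H₀) (π.avoid {H₀}))
      (π'' : Finpartition (A.restriction H₀ h₀).hyperplanes)
      (hπ'' : π''.parts = (π.parts.erase B).image (Finset.image (restrictTo H₀)))
      (hres : InductiveFactorization (A.restriction H₀ h₀) π'') : InductiveFactorization A π

end Arrangement

/-! The proof is an induction along the factorization, driven by Terao's addition theorem. Let `H₀ =
ker α` lie in the block `B`. Bijectivity of the restriction map gives `|A''| = |A \ B|`, hence `|A'|
- |A''| = |B| - 1 =: e`. By induction the exponents of `A''` are the sizes of the other blocks and
zeros, and those of `A'` are the same with `e` adjoined. Addition replaces `e` by `e + 1 = |B|`, and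
the inclusion needed for inductive freeness is visible.

Addition (`HasExponents.addition`) rests on two facts. There is a form `b` on `H₀` of degree `e`
dividing `θ(α)` modulo `α` for every `θ` in `D(A')` (`exists_dvd_polyRestrict`). Members of a basis
of `D(A')` that lie in `D(A)` stay independent when restricted to `H₀`
(`linearIndependent_restrictDer`). If all basis members of degree at most `e` lay in `D(A)`, their
restrictions would be one more than `D(A'')` has room for. So some `θ_k` of degree at most `e` has
`θ_k(α)` nonzero modulo `α`; this value is a multiple of `b`, so `θ_k` has degree `e` and the value
is a scalar times `b`. Subtracting multiples of `θ_k` from the other members and replacing `θ_k` by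
`α θ_k` gives a basis of `D(A)`.

Exponents are unique because homogeneity bounds the number of independent members of degree at most
`n` (`card_le_card_of_homogeneous`). -/

/-! ### Polynomial functions: grading, restriction to a hyperplane, divisibility by linear forms. -/

section PolynomialFunctions

variable {K : Type u} {V : Type v} [Field K] [AddCommGroup V] [Module K V]

lemma linForm_eq_zero_iff {α : Module.Dual K V} : linForm α = 0 ↔ α = 0 := by
  refine ⟨fun h => LinearMap.ext fun v => ?_, fun h => by simp [linForm, h]⟩
  have := congrArg (SymmetricAlgebra.lift (Module.Dual.eval K V v)) h
  simpa [linForm] using this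

lemma linForm_ne_zero {α : Module.Dual K V} (h : α ≠ 0) : linForm α ≠ 0 :=
  fun h0 => h (linForm_eq_zero_iff.mp h0)

lemma linForm_mem_homogPart (α : Module.Dual K V) : linForm α ∈ homogPart K V 1 := by
  rw [homogPart, pow_one]
  exact ⟨α, rfl⟩

lemma homogPart_mul_mem {m n : ℕ} {f g : PolyAlg K V} (hf : f ∈ homogPart K V m)
    (hg : g ∈ homogPart K V n) : f * g ∈ homogPart K V (m + n) := by
  rw [homogPart, pow_add]
  exact Submodule.mul_mem_mul hf hg

lemma mem_homogPart_zero {f : PolyAlg K V} :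
    f ∈ homogPart K V 0 ↔ ∃ c : K, algebraMap K (PolyAlg K V) c = f := by
  rw [homogPart, pow_zero, Submodule.mem_one]

lemma PolyAlg.derivation_ext {θ η : Derivation K (PolyAlg K V) (PolyAlg K V)}
    (h : ∀ α : Module.Dual K V, θ (linForm α) = η (linForm α)) : θ = η := by
  ext f
  induction f using SymmetricAlgebra.induction with
  | algebraMap r => simp
  | ι x => exact h x
  | mul a b ha hb => simp [ha, hb]
  | add a b ha hb => simp [ha, hb]

/-- Both gradings consist of the powers of their degree-one part, so matching the linear forms is
enough. This transports the grading of `MvPolynomial` to `S(V*)`. -/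
lemma equivMvPolynomial_mem_homogeneousSubmodule {κ : Type*}
    (b : Module.Basis κ K (Module.Dual K V)) (d : ℕ) (f : PolyAlg K V) :
    SymmetricAlgebra.equivMvPolynomial b f ∈ MvPolynomial.homogeneousSubmodule κ K d ↔
      f ∈ homogPart K V d := by
  have h1 : (LinearMap.range (SymmetricAlgebra.ι K (Module.Dual K V))).map
      (SymmetricAlgebra.equivMvPolynomial b).toAlgHom.toLinearMap =
        MvPolynomial.homogeneousSubmodule κ K 1 := by
    rw [MvPolynomial.homogeneousSubmodule_one_eq_span_X, LinearMap.range_eq_map, ← b.span_eq,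
      Submodule.map_span, Submodule.map_span, ← Set.range_comp, ← Set.range_comp]
    congr 2
    ext1 i
    simp
  have h2 : (homogPart K V d).map (SymmetricAlgebra.equivMvPolynomial b).toAlgHom.toLinearMap =
      MvPolynomial.homogeneousSubmodule κ K d := by
    rw [homogPart, Submodule.map_pow, h1, MvPolynomial.homogeneousSubmodule_one_pow]
  rw [← h2]
  constructor
  · rintro ⟨g, hg, hgf⟩
    exact (SymmetricAlgebra.equivMvPolynomial b).injective hgf ▸ hg
  · exact fun hf => ⟨f, hf, rfl⟩

section

attribute [local instance] MvPolynomial.gradedAlgebra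

/-- The projections of `S(V*)` onto its homogeneous components. -/
lemma exists_homogeneous_components (K : Type u) (V : Type v) [Field K] [AddCommGroup V]
    [Module K V] : ∃ c : ℕ → PolyAlg K V →ₗ[K] PolyAlg K V,
      (∀ n f, c n f ∈ homogPart K V n) ∧ (∀ n f, f ∈ homogPart K V n → c n f = f) ∧
      (∀ n d f h, h ∈ homogPart K V d → d ≤ n → c n (f * h) = c (n - d) f * h) ∧
      (∀ n d f h, h ∈ homogPart K V d → ¬ d ≤ n → c n (f * h) = 0) := by
  classical
  let b := Module.Basis.ofVectorSpace K (Module.Dual K V)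
  let e := SymmetricAlgebra.equivMvPolynomial b
  have hc : ∀ (n : ℕ)
      (p : MvPolynomial (Module.Basis.ofVectorSpaceIndex K (Module.Dual K V)) K),
      MvPolynomial.homogeneousComponent n p =
      (DirectSum.decompose (MvPolynomial.homogeneousSubmodule _ K) p n : MvPolynomial _ K) :=
    fun n p => (MvPolynomial.decomposition.decompose'_apply p n).symm
  have key := equivMvPolynomial_mem_homogeneousSubmodule b
  refine ⟨fun n => e.symm.toLinearMap ∘ₗ MvPolynomial.homogeneousComponent n ∘ₗ e.toLinearMap,
    fun n f => ?_, fun n f hf => ?_, fun n d f h hh hd => ?_, fun n d f h hh hd => ?_⟩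
  · rw [← key]
    simpa [e] using MvPolynomial.homogeneousComponent_isHomogeneous n (e f)
  · have := (key n f).mpr hf
    simp only [LinearMap.comp_apply, AlgEquiv.toLinearMap_apply]
    rw [AlgEquiv.symm_apply_eq, hc, DirectSum.decompose_of_mem_same _ this]
  · have := (key d h).mpr hh
    simp only [LinearMap.comp_apply, AlgEquiv.toLinearMap_apply]
    rw [AlgEquiv.symm_apply_eq, map_mul e, map_mul e, AlgEquiv.apply_symm_apply, hc, hc,
      DirectSum.coe_decompose_mul_of_right_mem_of_le _ this hd]
  · have := (key d h).mpr hh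
    simp only [LinearMap.comp_apply, AlgEquiv.toLinearMap_apply]
    rw [AlgEquiv.symm_apply_eq, map_mul e, map_zero, hc,
      DirectSum.coe_decompose_mul_of_right_mem_of_not_le _ this hd]

end

/-- The degree `n` component of `g * h` is the degree `n - d` component of `g` times `h`, and `h`
cancels. -/
lemma homogPart_of_mul {d n : ℕ} {g h : PolyAlg K V} (hh : h ∈ homogPart K V d)
    (hgh : g * h ∈ homogPart K V n) (h0 : g * h ≠ 0) : d ≤ n ∧ g ∈ homogPart K V (n - d) := by
  obtain ⟨c, hc1, hc2, hc3, hc4⟩ := exists_homogeneous_components K V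
  have hn : c n (g * h) = g * h := hc2 _ _ hgh
  have hd : d ≤ n := by
    by_contra hd
    exact h0 (by rw [← hn, hc4 n d g h hh hd])
  refine ⟨hd, ?_⟩
  rw [hc3 n d g h hh hd] at hn
  rw [← mul_right_cancel₀ (right_ne_zero_of_mul h0) hn]
  exact hc1 _ _

/-- Needed so that a product of pairwise coprime divisors is again a divisor. -/
noncomputable instance PolyAlg.uniqueFactorizationMonoid :
    UniqueFactorizationMonoid (PolyAlg K V) :=
  (SymmetricAlgebra.equivMvPolynomial
    (Module.Basis.ofVectorSpace K (Module.Dual K V))).symm.toMulEquiv.uniqueFactorizationMonoid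
    inferInstance

/-- Restriction of polynomial functions to a subspace. -/
noncomputable def polyRestrict (H : Submodule K V) : PolyAlg K V →ₐ[K] PolyAlg K H :=
  SymmetricAlgebra.lift (SymmetricAlgebra.ι K (Module.Dual K H) ∘ₗ H.subtype.dualMap)

lemma polyRestrict_linForm (H : Submodule K V) (α : Module.Dual K V) :
    polyRestrict H (linForm α) = linForm (α ∘ₗ H.subtype) := by
  simp only [polyRestrict, linForm, SymmetricAlgebra.lift_ι_apply]
  rfl

lemma polyRestrict_linForm_eq_zero {H : Submodule K V} {α : Module.Dual K V} :
    polyRestrict H (linForm α) = 0 ↔ H ≤ LinearMap.ker α := by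
  rw [polyRestrict_linForm, linForm_eq_zero_iff]
  exact ⟨fun h x hx => LinearMap.congr_fun h ⟨x, hx⟩, fun h => LinearMap.ext fun x => h x.2⟩

/-- Pullback of polynomial functions along a linear map onto a subspace. -/
noncomputable def polyExtend {H : Submodule K V} (p : V →ₗ[K] H) : PolyAlg K H →ₐ[K] PolyAlg K V :=
  SymmetricAlgebra.lift (SymmetricAlgebra.ι K (Module.Dual K V) ∘ₗ p.dualMap)

lemma polyExtend_linForm {H : Submodule K V} (p : V →ₗ[K] H) (β : Module.Dual K H) :
    polyExtend p (linForm β) = linForm (β ∘ₗ p) := by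
  simp only [polyExtend, linForm, SymmetricAlgebra.lift_ι_apply]
  rfl

lemma algHom_homogPart_mem {W : Type*} [AddCommGroup W] [Module K W]
    (φ : PolyAlg K V →ₐ[K] PolyAlg K W)
    (hφ : ∀ α, φ (linForm α) ∈ homogPart K W 1) {d : ℕ} {f : PolyAlg K V}
    (hf : f ∈ homogPart K V d) : φ f ∈ homogPart K W d := by
  have h1 : (LinearMap.range (SymmetricAlgebra.ι K (Module.Dual K V))).map φ.toLinearMap ≤
      LinearMap.range (SymmetricAlgebra.ι K (Module.Dual K W)) := by
    rintro _ ⟨_, ⟨α, rfl⟩, rfl⟩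
    simpa [homogPart] using hφ α
  have h2 : (homogPart K V d).map φ.toLinearMap ≤ homogPart K W d := by
    rw [homogPart, Submodule.map_pow]
    exact pow_le_pow_left' h1 d
  exact h2 ⟨f, hf, rfl⟩

lemma polyRestrict_homogPart {H : Submodule K V} {d : ℕ} {f : PolyAlg K V}
    (hf : f ∈ homogPart K V d) : polyRestrict H f ∈ homogPart K H d :=
  algHom_homogPart_mem _ (fun α => by
    rw [polyRestrict_linForm]; exact linForm_mem_homogPart _) hf

lemma polyExtend_homogPart {H : Submodule K V} (p : V →ₗ[K] H) {d : ℕ} {f : PolyAlg K H}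
    (hf : f ∈ homogPart K H d) : polyExtend p f ∈ homogPart K V d :=
  algHom_homogPart_mem _ (fun α => by
    rw [polyExtend_linForm]; exact linForm_mem_homogPart _) hf

lemma polyRestrict_polyExtend {H : Submodule K V} {p : V →ₗ[K] H} (hp : ∀ x : H, p x = x)
    (f : PolyAlg K H) : polyRestrict H (polyExtend p f) = f := by
  have : (polyRestrict H).comp (polyExtend p) = AlgHom.id K _ := by
    apply SymmetricAlgebra.algHom_ext
    ext1 β
    change polyRestrict H (polyExtend p (linForm β)) = linForm β
    rw [polyExtend_linForm, polyRestrict_linForm]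
    congr 1
    ext x
    simp [hp]
  exact congrArg (fun φ => φ f) this

lemma exists_smul_eq_of_ker_le {α β : Module.Dual K V} (h : LinearMap.ker α ≤ LinearMap.ker β) :
    ∃ c : K, β = c • α := by
  have hspan := mem_span_of_iInf_ker_le_ker (ι := Unit) (L := fun _ => α) (by simpa using h)
  simp only [Set.range_const, Submodule.mem_span_singleton] at hspan
  obtain ⟨c, hc⟩ := hspan
  exact ⟨c, hc.symm⟩

/-- If `p` is the projection onto `ker α` then `f` and its pullback under `p` agree
modulo `α`. -/
lemma dvd_sub_polyExtend_polyRestrict {α : Module.Dual K V} {p : V →ₗ[K] LinearMap.ker α}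
    (hp : ∀ x : LinearMap.ker α, p x = x) (f : PolyAlg K V) :
    linForm α ∣ f - polyExtend p (polyRestrict (LinearMap.ker α) f) := by
  let q := Ideal.Quotient.mkₐ K (Ideal.span {linForm α})
  -- Two algebra maps to `S/(α)` are compared on linear forms: `β` and `β ∘ p` agree on `ker α`, so
  -- they differ by a multiple of `α`.
  have : q = (q.comp (polyExtend p)).comp (polyRestrict (LinearMap.ker α)) := by
    apply SymmetricAlgebra.algHom_ext
    ext1 β
    change q (linForm β) = q (polyExtend p (polyRestrict (LinearMap.ker α) (linForm β)))
    rw [polyRestrict_linForm, polyExtend_linForm]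
    refine (Ideal.Quotient.eq).mpr (Ideal.mem_span_singleton.mpr ?_)
    have hle : LinearMap.ker α ≤
        LinearMap.ker (β - (β ∘ₗ (LinearMap.ker α).subtype) ∘ₗ p) := by
      intro x hx
      have := hp ⟨x, hx⟩
      simp only at this
      simp [this]
    obtain ⟨c, hc⟩ := exists_smul_eq_of_ker_le hle
    rw [linForm, linForm, ← map_sub, hc, map_smul]
    exact ⟨algebraMap K _ c, by rw [mul_comm, Algebra.smul_def]⟩
  have h2 := congrArg (fun φ => φ f) this
  exact Ideal.mem_span_singleton.mp ((Ideal.Quotient.eq).mp h2)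

lemma exists_projection (H : Submodule K V) : ∃ p : V →ₗ[K] H, ∀ x : H, p x = x := by
  obtain ⟨p, hp⟩ := H.subtype.exists_leftInverse_of_injective (by simp)
  exact ⟨p, fun x => LinearMap.congr_fun hp x⟩

/-- Computations modulo `α` can thus be made in `S(H*)` with `H = ker α`; as this is a domain, `α`
is prime. -/
lemma polyRestrict_eq_zero_iff {α : Module.Dual K V} {f : PolyAlg K V} :
    polyRestrict (LinearMap.ker α) f = 0 ↔ linForm α ∣ f := by
  obtain ⟨p, hp⟩ := exists_projection (LinearMap.ker α)
  constructor
  · intro h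
    simpa [h] using dvd_sub_polyExtend_polyRestrict hp f
  · rintro ⟨g, rfl⟩
    rw [map_mul, polyRestrict_linForm_eq_zero.mpr le_rfl, zero_mul]

lemma linForm_prime {α : Module.Dual K V} (hα : α ≠ 0) : Prime (linForm α) := by
  refine ⟨linForm_ne_zero hα, fun hu => ?_, fun f g hfg => ?_⟩
  · have h1 : polyRestrict (LinearMap.ker α) 1 = 0 :=
      polyRestrict_eq_zero_iff.mpr hu.dvd
    simp at h1
  · simpa only [← polyRestrict_eq_zero_iff, map_mul, mul_eq_zero] using hfg

lemma linForm_dvd_linForm {α β : Module.Dual K V} :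
    linForm α ∣ linForm β ↔ LinearMap.ker α ≤ LinearMap.ker β := by
  rw [← polyRestrict_eq_zero_iff, polyRestrict_linForm_eq_zero]

lemma ker_eq_of_ker_le {α β : Module.Dual K V} (hβ : β ≠ 0)
    (h : LinearMap.ker α ≤ LinearMap.ker β) : LinearMap.ker α = LinearMap.ker β := by
  obtain ⟨c, rfl⟩ := exists_smul_eq_of_ker_le h
  rw [LinearMap.ker_smul _ _ (fun hc => hβ (by simp [hc]))]

end PolynomialFunctions

/-! ### Homogeneous bases, uniqueness of exponents, and the empty arrangement. -/

lemma exists_basis_submodule_iff {R M ι : Type*} [Ring R] [AddCommGroup M] [Module R M]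
    {N : Submodule R M} {v : ι → M} :
    (∃ b : Module.Basis ι R N, ∀ i, (b i : M) = v i) ↔
      LinearIndependent R v ∧ Submodule.span R (Set.range v) = N := by
  constructor
  · rintro ⟨b, hb⟩
    obtain rfl : (fun i => (b i : M)) = v := funext hb
    refine ⟨b.linearIndependent.map' N.subtype N.ker_subtype, ?_⟩
    have : Set.range (fun i => (b i : M)) = N.subtype '' Set.range b := by
      rw [← Set.range_comp]; rfl
    rw [this, ← Submodule.map_span, b.span_eq, Submodule.map_top, Submodule.range_subtype]
  · rintro ⟨hli, rfl⟩
    exact ⟨Module.Basis.span hli, fun i => by rw [Module.Basis.span_apply]⟩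

section Exponents

variable {K : Type u} {V : Type v} [Field K] [AddCommGroup V] [Module K V]

lemma Derivation.sum_smul_apply {ι : Type*} (s : Finset ι) (f : ι → PolyAlg K V)
    (v : ι → Derivation K (PolyAlg K V) (PolyAlg K V)) (x : PolyAlg K V) :
    (∑ i ∈ s, f i • v i) x = ∑ i ∈ s, f i * v i x := by
  rw [← Derivation.coeFnAddMonoidHom_apply, map_sum, Finset.sum_apply]
  rfl

/-- In a combination of the `v i` equal to `θ`, each coefficient may be replaced by its component of
degree `m - d i`, or by zero if `d i > m`. -/
lemma IsHomogDerivation.mem_span_image {ι : Type*} [Fintype ι]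
    {v : ι → Derivation K (PolyAlg K V) (PolyAlg K V)} {d : ι → ℕ}
    (hv : ∀ i, IsHomogDerivation (v i) (d i))
    {θ : Derivation K (PolyAlg K V) (PolyAlg K V)} {m : ℕ} (hθ : IsHomogDerivation θ m)
    (hmem : θ ∈ Submodule.span (PolyAlg K V) (Set.range v)) :
    θ ∈ Submodule.span (PolyAlg K V) (v '' {i | d i ≤ m}) := by
  obtain ⟨c, hc1, hc2, hc3, hc4⟩ := exists_homogeneous_components K V
  obtain ⟨f, rfl⟩ := (Submodule.mem_span_range_iff_exists_fun _).mp hmem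
  have key : ∑ i, f i • v i = ∑ i, (if d i ≤ m then c (m - d i) (f i) else 0) • v i := by
    apply PolyAlg.derivation_ext
    intro α
    rw [← hc2 m _ (hθ α), Derivation.sum_smul_apply, Derivation.sum_smul_apply, map_sum]
    refine Finset.sum_congr rfl fun i _ => ?_
    split_ifs with h
    · exact hc3 _ _ _ _ (hv i α) h
    · rw [zero_mul]
      exact hc4 _ _ _ _ (hv i α) h
  rw [key]
  refine Submodule.sum_mem _ fun i _ => ?_
  split_ifs with h
  · exact Submodule.smul_mem _ _ (Submodule.subset_span ⟨i, h, rfl⟩)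
  · simp

/-- By degree the `u j` lie in the span of those `v i` with `d i ≤ n`, and the rank of a module
bounds its independent families and is bounded by the number of generators. -/
lemma card_le_card_of_homogeneous {ι J : Type*} [Fintype ι] [Fintype J]
    {v : ι → Derivation K (PolyAlg K V) (PolyAlg K V)} {d : ι → ℕ}
    (hv : ∀ i, IsHomogDerivation (v i) (d i))
    {u : J → Derivation K (PolyAlg K V) (PolyAlg K V)} {m : J → ℕ} {n : ℕ}
    (hu : ∀ j, IsHomogDerivation (u j) (m j)) (hm : ∀ j, m j ≤ n)
    (hli : LinearIndependent (PolyAlg K V) u)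
    (hmem : ∀ j, u j ∈ Submodule.span (PolyAlg K V) (Set.range v)) :
    Fintype.card J ≤ (Finset.univ.filter fun i => d i ≤ n).card := by
  classical
  let s : Finset (Derivation K (PolyAlg K V) (PolyAlg K V)) :=
    (Finset.univ.filter fun i => d i ≤ n).image v
  have himg : v '' {i | d i ≤ n} = s := by
    ext; simp [s]
  let N := Submodule.span (PolyAlg K V)
    (s : Set (Derivation K (PolyAlg K V) (PolyAlg K V)))
  have hN : ∀ j, u j ∈ N := fun j => by
    simp only [N]
    rw [← himg]
    exact Submodule.span_mono (Set.image_mono fun i (hi : d i ≤ m j) => hi.trans (hm j))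
      ((hu j).mem_span_image hv (hmem j))
  have hli' : LinearIndependent (PolyAlg K V) (fun j => (⟨u j, hN j⟩ : N)) :=
    LinearIndependent.of_comp N.subtype hli
  have hfin : Module.Finite (PolyAlg K V) N :=
    Module.Finite.span_of_finite _ (Finset.finite_toSet _)
  calc Fintype.card J ≤ Module.finrank (PolyAlg K V) N := hli'.fintype_card_le_finrank
    _ ≤ ((Finset.univ.filter fun i => d i ≤ n).image v).card :=
        finrank_span_finset_le_card _
    _ ≤ _ := Finset.card_image_le

namespace Arrangement

lemma hasExponents_iff {A : Arrangement K V} {E : Multiset ℕ} :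
    A.HasExponents E ↔ ∃ (v : Fin (Module.finrank K V) → Derivation K (PolyAlg K V) (PolyAlg K V))
      (d : Fin (Module.finrank K V) → ℕ), LinearIndependent (PolyAlg K V) v ∧
        Submodule.span (PolyAlg K V) (Set.range v) = A.logDer ∧
        (∀ i, IsHomogDerivation (v i) (d i)) ∧ E = Finset.univ.val.map d := by
  constructor
  · rintro ⟨b, d, hd, rfl⟩
    have := exists_basis_submodule_iff.mp ⟨b, fun i => rfl⟩
    exact ⟨fun i => b i, d, this.1, this.2, hd, rfl⟩
  · rintro ⟨v, d, hli, hsp, hd, rfl⟩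
    obtain ⟨b, hb⟩ := exists_basis_submodule_iff.mpr ⟨hli, hsp⟩
    exact ⟨b, d, fun i => by rw [hb]; exact hd i, rfl⟩

lemma HasExponents.card_eq {A : Arrangement K V} {E : Multiset ℕ} (h : A.HasExponents E) :
    Multiset.card E = Module.finrank K V := by
  obtain ⟨b, d, -, rfl⟩ := h
  simp

lemma HasExponents.countP_le {A : Arrangement K V} {E E' : Multiset ℕ} (h : A.HasExponents E)
    (h' : A.HasExponents E') (n : ℕ) : E.countP (· ≤ n) ≤ E'.countP (· ≤ n) := by
  classical
  obtain ⟨v, d, hli, hsp, hd, rfl⟩ := hasExponents_iff.mp h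
  obtain ⟨v', d', hli', hsp', hd', rfl⟩ := hasExponents_iff.mp h'
  have := card_le_card_of_homogeneous (J := {i // d i ≤ n}) (n := n) hd'
    (u := fun i => v i) (fun i => hd i) (fun i => i.2)
    (hli.comp _ Subtype.val_injective) (fun i => by
      rw [hsp', ← hsp]; exact Submodule.subset_span ⟨_, rfl⟩)
  rw [Fintype.card_subtype] at this
  rw [Multiset.countP_map, Multiset.countP_map]
  exact this

lemma eq_of_forall_countP_le_eq {E E' : Multiset ℕ}
    (h : ∀ n, E.countP (· ≤ n) = E'.countP (· ≤ n)) : E = E' := by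
  have key : ∀ (F : Multiset ℕ) (n : ℕ),
      F.countP (· ≤ n + 1) = F.countP (· ≤ n) + F.count (n + 1) := by
    intro F n
    induction F using Multiset.induction with
    | empty => simp
    | cons a F ih =>
      rw [Multiset.countP_cons, Multiset.countP_cons, Multiset.count_cons, ih]
      split_ifs <;> omega
  ext n
  cases n with
  | zero =>
    have := h 0
    simpa [Multiset.count, eq_comm] using this
  | succ n =>
    have h1 := h n
    have h2 := h (n + 1)
    rw [key, key] at h2
    omega

/-- The multiset of exponents of a free arrangement is unique. -/
lemma HasExponents.unique {A : Arrangement K V} {E E' : Multiset ℕ} (h : A.HasExponents E)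
    (h' : A.HasExponents E') : E = E' :=
  eq_of_forall_countP_le_eq fun n => le_antisymm (h.countP_le h' n) (h'.countP_le h n)

lemma span_linForm_eq {α β : Module.Dual K V} (h : LinearMap.ker α = LinearMap.ker β) :
    (Ideal.span {linForm α} : Ideal (PolyAlg K V)) = Ideal.span {linForm β} :=
  le_antisymm
    (Ideal.span_singleton_le_span_singleton.mpr (linForm_dvd_linForm.mpr h.ge))
    (Ideal.span_singleton_le_span_singleton.mpr (linForm_dvd_linForm.mpr h.le))

/-- Every derivation is logarithmic, and the partial derivatives in linear coordinates form a basis;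
they send linear forms to constants. -/
lemma hasExponents_of_empty [FiniteDimensional K V] {A : Arrangement K V}
    (hA : A.hyperplanes = ∅) :
    A.HasExponents (Multiset.replicate (Module.finrank K V) 0) := by
  classical
  let b := (Module.finBasis K V).dualBasis
  let e := SymmetricAlgebra.equivMvPolynomial b
  have he : ∀ i, e (linForm (b i)) = MvPolynomial.X i :=
    SymmetricAlgebra.equivMvPolynomial_ι_apply b
  have hlin : ∀ α : Module.Dual K V, linForm α =
      ∑ i, algebraMap K _ (b.repr α i) * linForm (b i) := by
    intro α
    conv_lhs => rw [← b.sum_repr α]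
    rw [linForm, map_sum]
    exact Finset.sum_congr rfl fun i _ => by rw [map_smul, Algebra.smul_def]
  let D : Fin (Module.finrank K V) → Derivation K (PolyAlg K V) (PolyAlg K V) := fun i =>
    Derivation.mk' (e.symm.toLinearMap ∘ₗ (MvPolynomial.pderiv i).toLinearMap ∘ₗ e.toLinearMap)
      (fun f g => by
        simp only [LinearMap.comp_apply, AlgEquiv.toLinearMap_apply]
        rw [AlgEquiv.symm_apply_eq, map_mul e]
        simp [Derivation.leibniz])
  have hD : ∀ i j, D i (linForm (b j)) = if i = j then 1 else 0 := by
    intro i j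
    change e.symm (MvPolynomial.pderiv i (e (linForm (b j)))) = _
    rw [he, AlgEquiv.symm_apply_eq, MvPolynomial.pderiv_X]
    split_ifs with h
    · subst h; simp
    · rw [Pi.single_eq_of_ne (Ne.symm h), map_zero]
  rw [hasExponents_iff]
  refine ⟨D, fun _ => 0, ?_, ?_, fun i α => ?_, by simp⟩
  · rw [Fintype.linearIndependent_iff]
    intro g hg j
    have := congrArg (fun θ => θ (linForm (b j))) hg
    simpa [Derivation.sum_smul_apply, hD] using this
  · have htop : A.logDer = ⊤ := by
      rw [eq_top_iff]
      intro θ _ H hH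
      simp [hA] at hH
    rw [htop, eq_top_iff]
    intro θ _
    have : θ = ∑ i, θ (linForm (b i)) • D i := by
      apply PolyAlg.derivation_ext
      intro α
      rw [hlin]
      simp only [map_sum, Derivation.leibniz, Derivation.map_algebraMap]
      simp [Derivation.sum_smul_apply, hD]
    rw [this]
    exact Submodule.sum_mem _ fun i _ =>
      Submodule.smul_mem _ _ (Submodule.subset_span ⟨i, rfl⟩)
  · rw [hlin, map_sum, mem_homogPart_zero]
    refine ⟨b.repr α i, ?_⟩
    simp only [Derivation.leibniz, Derivation.map_algebraMap]
    simp [hD]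

end Arrangement

end Exponents

/-! ### Logarithmic derivations under deletion and restriction. -/

section Restriction

variable {K : Type u} {V : Type v} [Field K] [AddCommGroup V] [Module K V]

/-- A derivation `θ` of `S(V*)` with `θ α ∈ (α)` induces this derivation of `S(H*)`, where
`H = ker α`; here `p` is a projection of `V` onto `H`. -/
noncomputable def restrictDer {H : Submodule K V} (p : V →ₗ[K] H) (hp : ∀ x : H, p x = x)
    (θ : Derivation K (PolyAlg K V) (PolyAlg K V)) : Derivation K (PolyAlg K H) (PolyAlg K H) :=
  Derivation.mk' ((polyRestrict H).toLinearMap ∘ₗ (θ : PolyAlg K V →ₗ[K] PolyAlg K V) ∘ₗ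
    (polyExtend p).toLinearMap) fun f g => by
      simp [polyRestrict_polyExtend hp]

lemma restrictDer_apply {H : Submodule K V} {p : V →ₗ[K] H} (hp : ∀ x : H, p x = x)
    (θ : Derivation K (PolyAlg K V) (PolyAlg K V)) (f : PolyAlg K H) :
    restrictDer p hp θ f = polyRestrict H (θ (polyExtend p f)) := rfl

lemma IsHomogDerivation.restrictDer {H : Submodule K V} {p : V →ₗ[K] H}
    (hp : ∀ x : H, p x = x) {θ : Derivation K (PolyAlg K V) (PolyAlg K V)} {d : ℕ}
    (hθ : IsHomogDerivation θ d) : IsHomogDerivation (restrictDer p hp θ) d := fun β => by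
  rw [restrictDer_apply, polyExtend_linForm]
  exact polyRestrict_homogPart (hθ _)

variable {α : Module.Dual K V}

/-- By the Leibniz rule `θ` preserves the ideal `(α)`, the kernel of restriction, so the choice of
`p` does not matter. -/
lemma restrictDer_polyRestrict {p : V →ₗ[K] LinearMap.ker α}
    (hp : ∀ x : LinearMap.ker α, p x = x) {θ : Derivation K (PolyAlg K V) (PolyAlg K V)}
    (hθ : linForm α ∣ θ (linForm α)) (f : PolyAlg K V) :
    restrictDer p hp θ (polyRestrict _ f) = polyRestrict _ (θ f) := by
  obtain ⟨g, hg⟩ := dvd_sub_polyExtend_polyRestrict hp f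
  have h1 : polyRestrict (LinearMap.ker α)
      (θ (f - polyExtend p (polyRestrict (LinearMap.ker α) f))) = 0 := by
    rw [hg, polyRestrict_eq_zero_iff, Derivation.leibniz]
    exact dvd_add (Dvd.intro _ rfl) (hθ.mul_left _)
  rw [map_sub, map_sub, sub_eq_zero] at h1
  rw [restrictDer_apply, h1]

lemma Derivation.exists_smul_eq_of_forall_dvd {a : PolyAlg K V} (ha : a ≠ 0)
    {θ : Derivation K (PolyAlg K V) (PolyAlg K V)} (h : ∀ f, a ∣ θ f) :
    ∃ η : Derivation K (PolyAlg K V) (PolyAlg K V), θ = a • η := by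
  choose g hg using h
  refine ⟨Derivation.mk' { toFun := g, map_add' := fun x y => ?_, map_smul' := fun c x => ?_ }
    fun x y => ?_, Derivation.ext hg⟩
  · apply mul_left_cancel₀ ha
    rw [mul_add, ← hg, ← hg, ← hg, map_add]
  · apply mul_left_cancel₀ ha
    rw [RingHom.id_apply, mul_smul_comm, ← hg, ← hg, Derivation.map_smul]
  · apply mul_left_cancel₀ ha
    change a * g (x * y) = a * (x • g y + y • g x)
    rw [← hg, Derivation.leibniz, hg, hg]
    simp only [smul_eq_mul]
    ring

lemma isRelPrime_linForm {β γ : Module.Dual K V} (hβ : β ≠ 0)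
    (h : ¬ LinearMap.ker β ≤ LinearMap.ker γ) : IsRelPrime (linForm β) (linForm γ) :=
  (linForm_prime hβ).irreducible.isRelPrime_iff_not_dvd.mpr fun hd => h (linForm_dvd_linForm.mp hd)

/-- A derivation which is logarithmic along the hyperplanes `β + c α = 0`, `c ∈ T`, all of which
meet `α = 0` in the same subspace. -/
lemma pow_dvd_polyRestrict_of_pencil {β : Module.Dual K V}
    (hα : α ≠ 0) (hβ : ¬ LinearMap.ker α ≤ LinearMap.ker β)
    {θ : Derivation K (PolyAlg K V) (PolyAlg K V)} (T : Finset K) (hT : T.Nonempty)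
    (hθ : ∀ c ∈ T, linForm (β + c • α) ∣ θ (linForm (β + c • α))) :
    polyRestrict (LinearMap.ker α) (linForm β) ^ (T.card - 1) ∣
      polyRestrict (LinearMap.ker α) (θ (linForm α)) := by
  have hker : ∀ c : K, ¬ LinearMap.ker α ≤ LinearMap.ker (β + c • α) := fun c h => hβ fun x hx => by
    have h1 := h hx
    rw [LinearMap.mem_ker] at hx h1 ⊢
    simpa [hx] using h1
  have hne : ∀ c : K, β + c • α ≠ 0 := fun c h => hker c (by simp [h])
  -- The expression `β θ(α) - α θ(β)` does not change when `β` is replaced by `β + c α`, so each of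
  -- these pairwise coprime forms divides it.
  have hdvd : ∏ c ∈ T, linForm (β + c • α) ∣
      linForm β * θ (linForm α) - linForm α * θ (linForm β) := by
    refine Finset.prod_dvd_of_isRelPrime (fun c _ c' _ hcc => ?_) fun c hc => ?_
    · refine isRelPrime_linForm (hne c) fun hle => hcc ?_
      obtain ⟨t, ht⟩ := exists_smul_eq_of_ker_le hle
      by_contra hcc'
      have hx : ∀ x, β x + c' * α x = t * (β x + c * α x) := fun x => by
        simpa [mul_add] using LinearMap.congr_fun ht x
      obtain ⟨x, hx1, hx2⟩ := SetLike.not_le_iff_exists.mp hβ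
      rw [LinearMap.mem_ker] at hx1 hx2
      have h1 := hx x
      rw [hx1] at h1
      have ht1 : t = 1 := mul_right_cancel₀ hx2 (by linear_combination -h1)
      apply hα
      ext y
      have h2 := hx y
      rw [ht1] at h2
      have h3 : (c' - c) * α y = 0 := by linear_combination h2
      exact (mul_eq_zero.mp h3).resolve_left (sub_ne_zero.mpr (Ne.symm hcc'))
    · have h1 := hθ c hc
      have h2 : linForm (β + c • α) = linForm β + c • linForm α := by simp [linForm]
      have h3 : linForm β * θ (linForm α) - linForm α * θ (linForm β) =
          linForm (β + c • α) * θ (linForm α) - linForm α * θ (linForm (β + c • α)) := by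
        rw [h2, map_add, Derivation.map_smul, Algebra.smul_def, Algebra.smul_def]
        ring
      rw [h3]
      exact dvd_sub (Dvd.intro _ rfl) (h1.mul_left _)
  -- Modulo `α` the expression becomes `β θ(α)` and the product becomes `β ^ T.card`; cancelling one
  -- factor `β` leaves the exponent `T.card - 1`.
  obtain ⟨R, hR⟩ := hdvd
  have h1 := congrArg (polyRestrict (LinearMap.ker α)) hR
  have h2 : ∀ c : K, polyRestrict (LinearMap.ker α) (linForm (β + c • α)) =
      polyRestrict (LinearMap.ker α) (linForm β) := fun c => by
    have h3 : linForm (β + c • α) = linForm β + c • linForm α := by simp [linForm]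
    rw [h3, map_add, map_smul, polyRestrict_linForm_eq_zero.mpr le_rfl, smul_zero, add_zero]
  rw [map_sub, map_mul, map_mul, map_mul, polyRestrict_linForm_eq_zero.mpr le_rfl, zero_mul,
    sub_zero, map_prod, Finset.prod_congr rfl fun c _ => h2 c, Finset.prod_const,
    ← Nat.sub_add_cancel hT.card_pos, pow_succ', mul_assoc] at h1
  refine ⟨_, mul_left_cancel₀ (fun h => hβ (polyRestrict_linForm_eq_zero.mp h)) h1⟩

namespace Arrangement

lemma mem_logDer_of_forms {A : Arrangement K V} {θ : Derivation K (PolyAlg K V) (PolyAlg K V)}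
    (h : ∀ H ∈ A.hyperplanes, ∃ β : Module.Dual K V, H = LinearMap.ker β ∧
      linForm β ∣ θ (linForm β)) : θ ∈ A.logDer := by
  intro H hH γ hγ
  obtain ⟨β, hβ, hd⟩ := h H hH
  obtain ⟨c, rfl⟩ := exists_smul_eq_of_ker_le (hβ.symm.trans hγ).le
  have h1 : linForm (c • β) = c • linForm β := by simp [linForm]
  rw [← span_linForm_eq (hβ.symm.trans hγ), Ideal.mem_span_singleton, h1, Derivation.map_smul,
    Algebra.smul_def]
  exact hd.mul_left _

lemma dvd_of_mem_logDer {A : Arrangement K V} {θ : Derivation K (PolyAlg K V) (PolyAlg K V)}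
    (h : θ ∈ A.logDer) {β : Module.Dual K V} (hβ : LinearMap.ker β ∈ A.hyperplanes) :
    linForm β ∣ θ (linForm β) :=
  Ideal.mem_span_singleton.mp (h _ hβ β rfl)

lemma mem_deletion {A : Arrangement K V} {H₀ H : Submodule K V} :
    H ∈ (A.deletion H₀).hyperplanes ↔ H ∈ A.hyperplanes ∧ H ≠ H₀ := by
  classical
  simp [deletion]

lemma mem_logDer_iff_deletion {A : Arrangement K V} (h₀ : LinearMap.ker α ∈ A.hyperplanes)
    {θ : Derivation K (PolyAlg K V) (PolyAlg K V)} :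
    θ ∈ A.logDer ↔
      θ ∈ (A.deletion (LinearMap.ker α)).logDer ∧ linForm α ∣ θ (linForm α) := by
  constructor
  · exact fun h => ⟨fun H hH => h H (mem_deletion.mp hH).1, dvd_of_mem_logDer h h₀⟩
  · rintro ⟨h1, h2⟩
    refine mem_logDer_of_forms fun H hH => ?_
    by_cases hne : H = LinearMap.ker α
    · exact ⟨α, hne, h2⟩
    · obtain ⟨β, -, rfl⟩ := A.exists_eq_ker H hH
      exact ⟨β, rfl, dvd_of_mem_logDer h1 (mem_deletion.mpr ⟨hH, hne⟩)⟩

lemma mem_restriction {A : Arrangement K V} {H₀ : Submodule K V} (h₀ : H₀ ∈ A.hyperplanes)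
    {X : Submodule K H₀} : X ∈ (A.restriction H₀ h₀).hyperplanes ↔
      ∃ H ∈ (A.deletion H₀).hyperplanes, restrictTo H₀ H = X := by
  simp [restriction, deletion]

lemma restrictDer_mem_logDer {A : Arrangement K V} (h₀ : LinearMap.ker α ∈ A.hyperplanes)
    {p : V →ₗ[K] LinearMap.ker α} (hp : ∀ x : LinearMap.ker α, p x = x)
    {θ : Derivation K (PolyAlg K V) (PolyAlg K V)} (hθ : θ ∈ A.logDer) :
    restrictDer p hp θ ∈ (A.restriction (LinearMap.ker α) h₀).logDer := by
  refine mem_logDer_of_forms fun X hX => ?_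
  obtain ⟨H, hH, rfl⟩ := (mem_restriction h₀).mp hX
  have hHA := (mem_deletion.mp hH).1
  obtain ⟨β, -, rfl⟩ := A.exists_eq_ker H hHA
  refine ⟨β ∘ₗ (LinearMap.ker α).subtype, (LinearMap.ker_comp _ _).symm, ?_⟩
  rw [← polyRestrict_linForm, restrictDer_polyRestrict hp (dvd_of_mem_logDer hθ h₀)]
  exact map_dvd _ (dvd_of_mem_logDer hθ hHA)

/-- Equal traces on `ker α` make the restricted forms proportional, so `δ = u β + t α`. Here `u ≠
0`, as otherwise `δ` and `α` would have the same kernel; dividing by `u` gives `c`. -/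
lemma exists_ker_add_smul {β δ : Module.Dual K V} (hδ : δ ≠ 0)
    (hne : LinearMap.ker δ ≠ LinearMap.ker α)
    (h : restrictTo (LinearMap.ker α) (LinearMap.ker δ) =
      restrictTo (LinearMap.ker α) (LinearMap.ker β)) :
    ∃ c : K, LinearMap.ker δ = LinearMap.ker (β + c • α) := by
  rw [restrictTo, restrictTo, ← LinearMap.ker_comp, ← LinearMap.ker_comp] at h
  obtain ⟨u, hu⟩ := exists_smul_eq_of_ker_le h.ge
  have hle : LinearMap.ker α ≤ LinearMap.ker (δ - u • β) := fun x hx => by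
    have := LinearMap.congr_fun hu ⟨x, hx⟩
    simp only [LinearMap.comp_apply, Submodule.subtype_apply, LinearMap.smul_apply] at this
    simp [this]
  obtain ⟨t, ht⟩ := exists_smul_eq_of_ker_le hle
  have hδ' : δ = u • β + t • α := by rw [← ht]; abel
  have hu0 : u ≠ 0 := by
    rintro rfl
    rw [zero_smul, zero_add] at hδ'
    refine hne ?_
    rw [hδ', LinearMap.ker_smul]
    rintro rfl
    exact hδ (by simpa using hδ')
  refine ⟨u⁻¹ * t, ?_⟩
  rw [hδ', ← LinearMap.ker_smul (β + (u⁻¹ * t) • α) u hu0, smul_add, smul_smul,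
    mul_inv_cancel_left₀ hu0]

/-- Terao's polynomial: for logarithmic derivations `θ` of the deletion, `θ α` is modulo `α` a
multiple of a fixed form of degree `|A'| - |A''|`. -/
lemma exists_dvd_polyRestrict (A : Arrangement K V) (hα : α ≠ 0)
    (h₀ : LinearMap.ker α ∈ A.hyperplanes) {e : ℕ}
    (he : e + (A.restriction _ h₀).hyperplanes.card =
      (A.deletion (LinearMap.ker α)).hyperplanes.card) :
    ∃ b ∈ homogPart K (LinearMap.ker α) e, ∀ θ ∈ (A.deletion (LinearMap.ker α)).logDer,
      b ∣ polyRestrict (LinearMap.ker α) (θ (linForm α)) := by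
  classical
  have hex : ∀ X ∈ (A.restriction _ h₀).hyperplanes, ∃ β : Module.Dual K V, β ≠ 0 ∧
      LinearMap.ker β ∈ (A.deletion (LinearMap.ker α)).hyperplanes ∧
      restrictTo (LinearMap.ker α) (LinearMap.ker β) = X := by
    intro X hX
    obtain ⟨H, hH, rfl⟩ := (mem_restriction h₀).mp hX
    obtain ⟨β, hβ, rfl⟩ := A.exists_eq_ker H (mem_deletion.mp hH).1
    exact ⟨β, hβ, hH, rfl⟩
  choose! β hβ0 hβA hβX using hex
  -- The fibres of `A' → A''` are the pencils to which `pow_dvd_polyRestrict_of_pencil` applies. A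
  -- fibre contributes its size minus one to the degree, which adds up to `|A'| - |A''| = e`.
  let F : Submodule K (LinearMap.ker α) → Finset (Submodule K V) := fun X =>
    (A.deletion (LinearMap.ker α)).hyperplanes.filter fun H => restrictTo _ H = X
  have hβF : ∀ X ∈ (A.restriction _ h₀).hyperplanes, LinearMap.ker (β X) ∈ F X := fun X hX =>
    Finset.mem_filter.mpr ⟨hβA X hX, hβX X hX⟩
  have hβα : ∀ X ∈ (A.restriction _ h₀).hyperplanes,
      ¬ LinearMap.ker α ≤ LinearMap.ker (β X) := fun X hX hle =>
    (mem_deletion.mp (hβA X hX)).2 (ker_eq_of_ker_le (hβ0 X hX) hle).symm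
  have hcard : (A.deletion (LinearMap.ker α)).hyperplanes.card =
      ∑ X ∈ (A.restriction _ h₀).hyperplanes, (F X).card :=
    Finset.card_eq_sum_card_fiberwise fun H hH => (mem_restriction h₀).mpr ⟨H, hH, rfl⟩
  have hdeg : e = ∑ X ∈ (A.restriction _ h₀).hyperplanes, ((F X).card - 1) := by
    have : ∑ X ∈ (A.restriction _ h₀).hyperplanes, (F X).card =
        ∑ X ∈ (A.restriction _ h₀).hyperplanes, ((F X).card - 1 + 1) :=
      Finset.sum_congr rfl fun X hX =>
        (Nat.sub_add_cancel (Finset.card_pos.mpr ⟨_, hβF X hX⟩)).symm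
    rw [Finset.sum_add_distrib, Finset.sum_const, smul_eq_mul, mul_one] at this
    omega
  have hpow : ∀ (H : Submodule K V) (γ : Module.Dual K V) (n : ℕ),
      polyRestrict H (linForm γ) ^ n ∈ homogPart K H n := fun H γ n => by
    induction n with
    | zero => exact mem_homogPart_zero.mpr ⟨1, by simp⟩
    | succ n ih =>
      rw [pow_succ]
      exact homogPart_mul_mem ih (polyRestrict_homogPart (linForm_mem_homogPart γ))
  refine ⟨∏ X ∈ (A.restriction _ h₀).hyperplanes,
    polyRestrict _ (linForm (β X)) ^ ((F X).card - 1), ?_, fun θ hθ => ?_⟩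
  · rw [hdeg]
    generalize (A.restriction _ h₀).hyperplanes = s
    induction s using Finset.induction_on with
    | empty => exact mem_homogPart_zero.mpr ⟨1, by simp⟩
    | insert X s hX ih =>
      rw [Finset.prod_insert hX, Finset.sum_insert hX]
      exact homogPart_mul_mem (hpow _ _ _) ih
  · refine Finset.prod_dvd_of_isRelPrime (fun X hX Y hY hXY => ?_) fun X hX => ?_
    · refine IsRelPrime.pow ?_
      rw [polyRestrict_linForm, polyRestrict_linForm]
      have hne : ∀ Z ∈ (A.restriction _ h₀).hyperplanes,
          β Z ∘ₗ (LinearMap.ker α).subtype ≠ 0 := fun Z hZ h0 =>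
        hβα Z hZ fun x hx => LinearMap.congr_fun h0 ⟨x, hx⟩
      refine isRelPrime_linForm (hne X hX) fun hle => hXY ?_
      have := ker_eq_of_ker_le (hne Y hY) hle
      rw [LinearMap.ker_comp, LinearMap.ker_comp] at this
      rw [← hβX X hX, ← hβX Y hY]
      exact this
    · have hc : ∀ H ∈ F X, ∃ c : K, H = LinearMap.ker (β X + c • α) := by
        intro H hH
        obtain ⟨hH1, hH2⟩ := Finset.mem_filter.mp hH
        obtain ⟨hHA, hne⟩ := mem_deletion.mp hH1
        obtain ⟨δ, hδ, rfl⟩ := A.exists_eq_ker H hHA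
        exact exists_ker_add_smul hδ hne (hH2.trans (hβX X hX).symm)
      choose! c hc using hc
      have hinj : Set.InjOn c (F X) := fun H hH H' hH' h => by
        rw [hc H hH, hc H' hH', h]
      rw [← Finset.card_image_of_injOn hinj]
      refine pow_dvd_polyRestrict_of_pencil hα (hβα X hX) _
        (Finset.Nonempty.image ⟨_, hβF X hX⟩ c) fun t ht => ?_
      obtain ⟨H, hH, rfl⟩ := Finset.mem_image.mp ht
      exact dvd_of_mem_logDer hθ (hc H hH ▸ (Finset.mem_filter.mp hH).1)

end Arrangement

end Restriction

/-! ### Passing from a basis of a module to a basis of a submodule. -/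

section BasisModification

variable {R M ι : Type*} [CommRing R] [AddCommGroup M] [Module R M] [Fintype ι]
  [DecidableEq ι] {v : ι → M} {k : ι} {a : R} {f : ι → R}

/-- In a relation with coefficients `g`, the coefficient of `v i` for `i ≠ k` is `g i`, and that of
`v k` is `g k * a - ∑ g j * f j`. The former vanish, and then so does the sum, because `f k = 0`. -/
lemma LinearIndependent.smul_sub_smul [IsDomain R] (hv : LinearIndependent R v) (ha : a ≠ 0)
    (hf : f k = 0) :
    LinearIndependent R fun i => (if i = k then a else 1) • v i - f i • v k := by
  rw [Fintype.linearIndependent_iff] at hv ⊢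
  intro g hg
  have h1 := hv (fun i => g i * (if i = k then a else 1) -
      if i = k then ∑ j, g j * f j else 0) (by
    rw [← hg]
    simp only [sub_smul, smul_sub, Finset.sum_sub_distrib, mul_smul, ite_smul, zero_smul,
      Finset.sum_ite_eq', Finset.mem_univ, if_true, Finset.sum_smul])
  have h2 : ∀ i, i ≠ k → g i = 0 := fun i hi => by simpa [hi] using h1 i
  have h3 : ∑ j, g j * f j = 0 := Finset.sum_eq_zero fun j _ => by
    by_cases hj : j = k
    · rw [hj, hf, mul_zero]
    · rw [h2 j hj, zero_mul]
  intro i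
  by_cases hi : i = k
  · subst hi
    simpa [h3, ha] using h1 i
  · exact h2 i hi

/-- Subtracting from an element of `N` the right multiples of the new vectors with `i ≠ k` leaves a
multiple of `v k` in `N`, which `hdvd` makes a multiple of `a • v k`. -/
lemma Submodule.span_smul_sub_smul_eq {N : Submodule R M} (hf : f k = 0)
    (hN : N ≤ Submodule.span R (Set.range v))
    (hmem : ∀ i, (if i = k then a else 1) • v i - f i • v k ∈ N)
    (hdvd : ∀ r : R, r • v k ∈ N → a ∣ r) :
    Submodule.span R (Set.range fun i => (if i = k then a else 1) • v i - f i • v k) = N := by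
  refine le_antisymm (Submodule.span_le.mpr (Set.range_subset_iff.mpr hmem)) fun x hx => ?_
  obtain ⟨c, rfl⟩ := (Submodule.mem_span_range_iff_exists_fun R).mp (hN hx)
  set w : ι → M := fun i => (if i = k then a else 1) • v i - f i • v k with hw
  set y := ∑ i ∈ Finset.univ.erase k, c i • w i with hy
  have hyN : y ∈ N := N.sum_mem fun i _ => N.smul_mem _ (hmem i)
  have hxy : ∑ i, c i • v i =
      y + (c k + ∑ i ∈ Finset.univ.erase k, c i * f i) • v k := by
    have : y = ∑ i ∈ Finset.univ.erase k, (c i • v i - (c i * f i) • v k) :=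
      Finset.sum_congr rfl fun i hi => by
        simp [hw, (Finset.mem_erase.mp hi).1, smul_sub, mul_smul]
    rw [this, Finset.sum_sub_distrib, ← Finset.sum_smul, add_smul,
      ← Finset.add_sum_erase _ _ (Finset.mem_univ k)]
    abel
  obtain ⟨s, hs⟩ := hdvd _ (by
    have := N.sub_mem hx hyN
    rwa [hxy, add_sub_cancel_left] at this)
  have hwk : w k = a • v k := by simp [hw, hf]
  rw [hxy, hs, mul_comm a s, mul_smul, ← hwk]
  exact Submodule.add_mem _
    (Submodule.sum_mem _ fun i _ => Submodule.smul_mem _ _ (Submodule.subset_span ⟨i, rfl⟩))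
    (Submodule.smul_mem _ _ (Submodule.subset_span ⟨k, rfl⟩))

end BasisModification

/-! ### The addition theorem. -/

namespace Arrangement

variable {K : Type u} {V : Type v} [Field K] [AddCommGroup V] [Module K V]
  {α : Module.Dual K V}

/-- A relation on `H₀` lifts to a combination `∑ G i • v i` divisible by `α`. The quotient is still
in `D(A')`, so by independence of `v` every `G i` is a multiple of `α` and restricts to zero. -/
lemma linearIndependent_restrictDer {A : Arrangement K V} (hα : α ≠ 0)
    (h₀ : LinearMap.ker α ∈ A.hyperplanes)
    {p : V →ₗ[K] LinearMap.ker α} (hp : ∀ x : LinearMap.ker α, p x = x)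
    {ι : Type*} [Fintype ι] {v : ι → Derivation K (PolyAlg K V) (PolyAlg K V)}
    (hv : LinearIndependent (PolyAlg K V) v)
    (hsp : Submodule.span (PolyAlg K V) (Set.range v) = (A.deletion (LinearMap.ker α)).logDer)
    (P : ι → Prop) (hP : ∀ i, P i → v i ∈ A.logDer) :
    LinearIndependent (PolyAlg K (LinearMap.ker α))
      fun i : {i // P i} => restrictDer p hp (v i) := by
  classical
  rw [Fintype.linearIndependent_iff]
  intro g hg
  let G : ι → PolyAlg K V := fun i => if h : P i then polyExtend p (g ⟨i, h⟩) else 0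
  have hGP : ∀ i : {i // P i}, G i = polyExtend p (g i) := fun i => dif_pos i.2
  have hGN : ∀ i : {i // ¬ P i}, G i = 0 := fun i => dif_neg i.2
  have hdvd : ∀ x, linForm α ∣ (∑ i, G i • v i) x := by
    intro x
    rw [← polyRestrict_eq_zero_iff, Derivation.sum_smul_apply, map_sum,
      ← Fintype.sum_subtype_add_sum_subtype P, Finset.sum_eq_zero (s := Finset.univ
        (α := {i // ¬ P i})) (fun i _ => by rw [hGN, zero_mul, map_zero]), add_zero]
    have h1 := congrArg (fun θ => θ (polyRestrict (LinearMap.ker α) x)) hg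
    simp only [Derivation.sum_smul_apply] at h1
    refine Eq.trans (Finset.sum_congr rfl fun i _ => ?_) h1
    rw [hGP, map_mul, polyRestrict_polyExtend hp,
      restrictDer_polyRestrict hp (dvd_of_mem_logDer (hP i i.2) h₀)]
  obtain ⟨η, hη⟩ := Derivation.exists_smul_eq_of_forall_dvd (linForm_ne_zero hα) hdvd
  -- Dividing by `α` keeps the conditions along `A'`, because the forms of the other hyperplanes are
  -- primes not dividing `α`.
  have hηmem : η ∈ (A.deletion (LinearMap.ker α)).logDer := by
    refine mem_logDer_of_forms fun H hH => ?_
    obtain ⟨hHA, hne⟩ := mem_deletion.mp hH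
    obtain ⟨β, hβ, rfl⟩ := A.exists_eq_ker H hHA
    refine ⟨β, rfl, ?_⟩
    have h1 : ∑ i, G i • v i ∈ (A.deletion (LinearMap.ker α)).logDer := by
      rw [← hsp]
      exact Submodule.sum_mem _ fun i _ =>
        Submodule.smul_mem _ _ (Submodule.subset_span ⟨i, rfl⟩)
    have h2 := dvd_of_mem_logDer h1 hH
    rw [hη] at h2
    exact ((linForm_prime hβ).dvd_or_dvd h2).resolve_left fun h =>
      hne (ker_eq_of_ker_le hα (linForm_dvd_linForm.mp h))
  rw [← hsp] at hηmem
  obtain ⟨h, rfl⟩ := (Submodule.mem_span_range_iff_exists_fun _).mp hηmem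
  have hzero := Fintype.linearIndependent_iff.mp hv (fun i => G i - linForm α * h i) (by
    simp only [sub_smul, mul_smul, Finset.sum_sub_distrib]
    rw [hη, Finset.smul_sum, sub_self])
  intro i
  have h1 : G i = linForm α * h i := sub_eq_zero.mp (hzero i)
  rw [← polyRestrict_polyExtend hp (g i), ← hGP, polyRestrict_eq_zero_iff, h1]
  exact Dvd.intro _ rfl

/-- **Terao's addition theorem**, with the degree of the missing exponent given by the numbers
of hyperplanes. -/
theorem HasExponents.addition {A : Arrangement K V} (hα : α ≠ 0)
    (h₀ : LinearMap.ker α ∈ A.hyperplanes) {e : ℕ} {E : Multiset ℕ}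
    (he : e + (A.restriction _ h₀).hyperplanes.card =
      (A.deletion (LinearMap.ker α)).hyperplanes.card)
    (hdel : (A.deletion (LinearMap.ker α)).HasExponents (e ::ₘ E))
    (hres : (A.restriction _ h₀).HasExponents E) : A.HasExponents ((e + 1) ::ₘ E) := by
  classical
  obtain ⟨p, hp⟩ := exists_projection (LinearMap.ker α)
  obtain ⟨v, d, hli, hsp, hd, hE⟩ := hasExponents_iff.mp hdel
  obtain ⟨v'', d'', -, hsp'', hd'', hE''⟩ := hasExponents_iff.mp hres
  obtain ⟨b, hb, hbdvd⟩ := exists_dvd_polyRestrict A hα h₀ he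
  have hvmem : ∀ i, v i ∈ (A.deletion (LinearMap.ker α)).logDer := fun i => by
    rw [← hsp]
    exact Submodule.subset_span ⟨i, rfl⟩
  -- Otherwise all `v i` of degree at most `e` restrict to independent members of `D(A'')`. But `e
  -- ::ₘ E` has one more entry at most `e` than `E` has.
  obtain ⟨k, hke, hk⟩ : ∃ k, d k ≤ e ∧ ¬ linForm α ∣ v k (linForm α) := by
    by_contra! hcon
    have hmem : ∀ i, d i ≤ e → v i ∈ A.logDer := fun i hi =>
      (mem_logDer_iff_deletion h₀).mpr ⟨hvmem i, hcon i hi⟩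
    have hcard := card_le_card_of_homogeneous (n := e) hd''
      (u := fun i : {i // d i ≤ e} => restrictDer p hp (v i))
      (fun i => (hd i).restrictDer hp) (fun i => i.2)
      (linearIndependent_restrictDer hα h₀ hp hli hsp _ hmem)
      (fun i => by rw [hsp'']; exact restrictDer_mem_logDer h₀ hp (hmem i i.2))
    have h1 : (e ::ₘ E).countP (· ≤ e) = Fintype.card {i // d i ≤ e} := by
      rw [hE, Multiset.countP_map, Fintype.card_subtype]
      rfl
    have h2 : E.countP (· ≤ e) = (Finset.univ.filter fun i => d'' i ≤ e).card := by
      rw [hE'', Multiset.countP_map]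
      rfl
    rw [Multiset.countP_cons_of_pos (p := (· ≤ e)) _ le_rfl] at h1
    omega
  choose g hg using fun i => hbdvd (v i) (hvmem i)
  -- Since `b` has degree `e`, a nonzero cofactor `g i` has degree `d i - e`. For `k` this forces `d
  -- k = e`, so that `g k` is a nonzero scalar `c`.
  have hgdeg : ∀ i, g i ≠ 0 → e ≤ d i ∧ g i ∈ homogPart K (LinearMap.ker α) (d i - e) := by
    intro i hi
    have hb0 : b ≠ 0 := by
      rintro rfl
      have := hg k
      rw [zero_mul, polyRestrict_eq_zero_iff] at this
      exact hk this
    refine homogPart_of_mul hb ?_ (mul_ne_zero hi hb0)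
    rw [mul_comm, ← hg i]
    exact polyRestrict_homogPart (hd i α)
  have hgk : g k ≠ 0 := fun h0 => hk (by
    rw [← polyRestrict_eq_zero_iff, hg k, h0, mul_zero])
  have hdk : d k = e := le_antisymm hke (hgdeg k hgk).1
  obtain ⟨c, hc⟩ := mem_homogPart_zero.mp (by
    have := (hgdeg k hgk).2
    rwa [hdk, Nat.sub_self] at this)
  have hc0 : c ≠ 0 := by
    rintro rfl
    exact hgk (by rw [← hc, map_zero])
  -- Modulo `α`, `v i` and `v k` take `α` to `b * g i` and `c b`, so subtracting `c⁻¹ g i` times `v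
  -- k` makes the value of `v i` at `α` vanish.
  let f : Fin (Module.finrank K V) → PolyAlg K V := fun i =>
    if i = k then 0 else polyExtend p (c⁻¹ • g i)
  have hfk : f k = 0 := if_pos rfl
  have hfi : ∀ i, i ≠ k → f i = polyExtend p (c⁻¹ • g i) := fun i hi => if_neg hi
  refine hasExponents_iff.mpr
    ⟨fun i => (if i = k then linForm α else 1) • v i - f i • v k, Function.update d k (e + 1),
      hli.smul_sub_smul (linForm_ne_zero hα) hfk, Submodule.span_smul_sub_smul_eq hfk ?_ ?_ ?_,
      ?_, ?_⟩
  · rw [hsp]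
    exact fun θ hθ => ((mem_logDer_iff_deletion h₀).mp hθ).1
  · refine fun i => (mem_logDer_iff_deletion h₀).mpr
      ⟨Submodule.sub_mem _ (Submodule.smul_mem _ _ (hvmem i))
        (Submodule.smul_mem _ _ (hvmem k)), ?_⟩
    by_cases hi : i = k
    · subst hi
      simp [hfk]
    · rw [← polyRestrict_eq_zero_iff]
      simp only [hi, if_false, one_smul, Derivation.sub_apply, Derivation.smul_apply,
        smul_eq_mul, map_sub, map_mul, hg, hfi i hi, polyRestrict_polyExtend hp, ← hc]
      rw [Algebra.smul_def]
      have : algebraMap K (PolyAlg K (LinearMap.ker α)) c⁻¹ * algebraMap K _ c = 1 := by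
        rw [← map_mul, inv_mul_cancel₀ hc0, map_one]
      linear_combination -(b * g i) * this
  · intro r hr
    have h1 := dvd_of_mem_logDer hr h₀
    exact ((linForm_prime hα).dvd_or_dvd h1).resolve_right hk
  · intro i β
    by_cases hi : i = k
    · subst hi
      simp only [if_true, hfk, zero_smul, sub_zero, Function.update_self, Derivation.smul_apply,
        smul_eq_mul]
      rw [add_comm, ← hdk]
      exact homogPart_mul_mem (linForm_mem_homogPart α) (hd i β)
    · simp only [hi, if_false, one_smul, Function.update_of_ne (Ne.symm (Ne.symm hi)),
        Derivation.sub_apply, Derivation.smul_apply, smul_eq_mul]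
      refine Submodule.sub_mem _ (hd i β) ?_
      -- If `g i = 0`, then `d i` may be smaller than `e`, but nothing is subtracted. Otherwise `f
      -- i` has degree `d i - e`, and the subtracted term has degree `d i`.
      by_cases hgi : g i = 0
      · simp [hfi i hi, hgi]
      · obtain ⟨h1, h2⟩ := hgdeg i hgi
        rw [← Nat.sub_add_cancel h1, hfi i hi]
        refine homogPart_mul_mem (polyExtend_homogPart p (Submodule.smul_mem _ _ h2)) ?_
        rw [← hdk]
        exact hd k β
  · have huniv : (Finset.univ : Finset (Fin (Module.finrank K V))).val =
        k ::ₘ (Finset.univ.erase k).val := by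
      rw [Finset.erase_val, Multiset.cons_erase (Finset.mem_univ k)]
    rw [huniv, Multiset.map_cons, hdk, Multiset.cons_inj_right] at hE
    rw [huniv, Multiset.map_cons, Function.update_self, hE, Multiset.cons_inj_right]
    refine Multiset.map_congr rfl fun i hi => ?_
    rw [Function.update_of_ne (Finset.mem_erase.mp (Finset.mem_val.mp hi)).1]

end Arrangement

/-! ### Rank, block sizes, and the induction. -/

namespace Arrangement

variable {K : Type u} {V : Type v} [Field K] [AddCommGroup V] [Module K V]

/-- The center lies in `H₀` and is also the center of the restriction; only the ambient dimension
drops by one. -/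
lemma rank_eq_rank_restriction_add_one [FiniteDimensional K V] (A : Arrangement K V)
    {H₀ : Submodule K V} (h₀ : H₀ ∈ A.hyperplanes)
    (hH₀ : Module.finrank K H₀ + 1 = Module.finrank K V) :
    A.rank = (A.restriction H₀ h₀).rank + 1 := by
  have hmap : A.hyperplanes.inf id =
      ((A.restriction H₀ h₀).hyperplanes.inf id).map H₀.subtype := by
    ext x
    simp only [Submodule.mem_finsetInf, id, Submodule.mem_map, Submodule.subtype_apply]
    constructor
    · intro hx
      refine ⟨⟨x, hx _ h₀⟩, fun X hX => ?_, rfl⟩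
      obtain ⟨H, hH, rfl⟩ := (mem_restriction h₀).mp hX
      exact hx H (mem_deletion.mp hH).1
    · rintro ⟨y, hy, rfl⟩ H hH
      by_cases hne : H = H₀
      · exact hne ▸ y.2
      · exact hy _ ((mem_restriction h₀).mpr ⟨H, mem_deletion.mpr ⟨hH, hne⟩, rfl⟩)
  have h1 := Submodule.finrank_quotient_add_finrank (A.hyperplanes.inf id)
  have h2 := Submodule.finrank_quotient_add_finrank ((A.restriction H₀ h₀).hyperplanes.inf id)
  have h3 := Submodule.finrank_map_subtype_eq H₀ ((A.restriction H₀ h₀).hyperplanes.inf id)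
  rw [← hmap] at h3
  rw [rank, rank]
  omega

open Classical in
-- Injectivity off `B` preserves the block sizes and keeps different blocks from having the same
-- image, so multiplicities survive.
lemma card_image_parts {ι κ : Type*} {s B : Finset ι} (π : Finpartition s) (hB : B ∈ π.parts)
    {f : ι → κ} (hf : Set.InjOn f (s \ B : Finset ι)) :
    ((π.parts.erase B).image (Finset.image f)).val.map Finset.card =
      (π.parts.erase B).val.map Finset.card := by
  have hsub : ∀ C ∈ π.parts.erase B, C ⊆ s \ B := fun C hC => by
    obtain ⟨hne, hCπ⟩ := Finset.mem_erase.mp hC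
    exact Finset.subset_sdiff.mpr ⟨π.le hCπ, π.disjoint hCπ hB hne⟩
  have hinj : Set.InjOn (Finset.image f) (π.parts.erase B) := fun C hC C' hC' h => by
    have h' := congrArg (fun t : Finset κ => (t : Set κ)) h
    simp only [Finset.coe_image] at h'
    exact Finset.coe_injective ((hf.image_eq_image_iff
      (Finset.coe_subset.mpr (hsub C hC)) (Finset.coe_subset.mpr (hsub C' hC'))).mp h')
  rw [Finset.image_val_of_injOn hinj, Multiset.map_map]
  exact Multiset.map_congr rfl fun C hC =>
    Finset.card_image_of_injOn (hf.mono (Finset.coe_subset.mpr (hsub C hC)))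

/-- Only `B` contains `x`, so no other block changes, and `B` disappears exactly when it is `{x}`.
-/
lemma avoid_singleton_parts {ι : Type*} [DecidableEq ι] {s B : Finset ι} (π : Finpartition s)
    (hB : B ∈ π.parts) {x : ι} (hx : x ∈ B) : (π.avoid {x}).parts =
      if B = {x} then π.parts.erase B else insert (B \ {x}) (π.parts.erase B) := by
  have hother : ∀ C ∈ π.parts, C ≠ B → x ∉ C := fun C hC hne hxC =>
    Finset.disjoint_left.mp (π.disjoint hC hB hne) hxC hx
  have hle : ∀ C ∈ π.parts, C ≤ {x} ↔ C = B ∧ B = {x} := fun C hC => by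
    rw [Finset.subset_singleton_iff]
    constructor
    · rintro (h | h)
      · exact absurd h (π.ne_bot hC)
      · have : C = B := by
          by_contra hne
          exact hother C hC hne (by simp [h])
        exact ⟨this, this ▸ h⟩
    · rintro ⟨rfl, h⟩
      exact Or.inr h
  have hsd : ∀ C ∈ π.parts, C ≠ B → C \ {x} = C := fun C hC hne =>
    Finset.sdiff_eq_self_of_disjoint (Finset.disjoint_singleton_right.mpr (hother C hC hne))
  ext C
  rw [Finpartition.mem_avoid]
  split_ifs with hBx
  · rw [Finset.mem_erase]
    constructor
    · rintro ⟨D, hD, hnle, rfl⟩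
      have hne : D ≠ B := fun h => hnle ((hle D hD).mpr ⟨h, hBx⟩)
      rw [hsd D hD hne]
      exact ⟨hne, hD⟩
    · rintro ⟨hne, hC⟩
      exact ⟨C, hC, fun h => hne ((hle C hC).mp h).1, hsd C hC hne⟩
  · rw [Finset.mem_insert, Finset.mem_erase]
    constructor
    · rintro ⟨D, hD, -, rfl⟩
      by_cases hne : D = B
      · exact Or.inl (by rw [hne])
      · rw [hsd D hD hne]
        exact Or.inr ⟨hne, hD⟩
    · rintro (rfl | ⟨hne, hC⟩)
      · exact ⟨B, hB, fun h => hBx ((hle B hB).mp h).2, rfl⟩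
      · exact ⟨C, hC, fun h => hne ((hle C hC).mp h).1, hsd C hC hne⟩

lemma avoid_singleton_parts_card {ι : Type*} [DecidableEq ι] {s B : Finset ι}
    (π : Finpartition s) (hB : B ∈ π.parts) {x : ι} (hx : x ∈ B) {M : Multiset ℕ}
    (hM : π.parts.val.map Finset.card = B.card ::ₘ M) :
    (π.avoid {x}).parts.val.map Finset.card = if B.card = 1 then M else (B.card - 1) ::ₘ M := by
  have hB1 : B = {x} ↔ B.card = 1 := by
    refine ⟨fun h => by rw [h, Finset.card_singleton], fun h => ?_⟩
    exact (Finset.eq_of_subset_of_card_le (Finset.singleton_subset_iff.mpr hx) (by simp [h])).symm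
  have hM' : (π.parts.erase B).val.map Finset.card = M := by
    rw [← Multiset.cons_inj_right B.card, ← hM, Finset.erase_val, ← Multiset.map_cons,
      Multiset.cons_erase hB]
  rw [avoid_singleton_parts π hB hx]
  simp only [hB1]
  split_ifs with hBx
  · exact hM'
  · have hnot : B \ {x} ∉ π.parts.erase B := fun h => by
      obtain ⟨hne, h⟩ := Finset.mem_erase.mp h
      have hdis := (π.disjoint h hB hne).mono_right (Finset.sdiff_subset (t := {x}))
      exact π.ne_bot h (Finset.disjoint_self_iff_empty _ |>.mp hdis)
    rw [Finset.insert_val_of_notMem hnot, Multiset.map_cons, Finset.card_sdiff_of_subset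
      (Finset.singleton_subset_iff.mpr hx), Finset.card_singleton, hM']

theorem InductiveFactorization.rank_and_exponents {A : Arrangement K V}
    {π : Finpartition A.hyperplanes} (hπ : A.InductiveFactorization π) [FiniteDimensional K V] :
    A.rank = π.parts.card ∧ A.InductivelyFree ∧
      A.HasExponents (Multiset.replicate (Module.finrank K V - π.parts.card) 0 +
          π.parts.val.map Finset.card) := by
  classical
  -- The ambient space varies in the induction, since the restriction lives in `H₀`; its finite
  -- dimensionality therefore has to be part of the statement.
  rename_i hfd
  revert hfd
  induction hπ with
  | empty A hA π =>
    intro hfd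
    have hparts : π.parts = ∅ := by
      rw [Finset.eq_empty_iff_forall_notMem]
      intro C hC
      have h1 := π.le hC
      rw [hA] at h1
      exact π.ne_bot hC (Finset.subset_empty.mp h1)
    refine ⟨?_, .empty A hA, ?_⟩
    · rw [hparts, rank, hA, Finset.inf_empty, Finset.card_empty]
      exact Module.finrank_zero_of_subsingleton
    · rw [hparts]
      simpa using hasExponents_of_empty hA
  | @add V _ _ A π B hB H₀ h₀ hH₀ hbij hdel π'' hπ'' hres ihdel ihres =>
    intro hfd
    obtain ⟨-, hfree', hexp'⟩ := ihdel
    obtain ⟨hrank'', hfree'', hexp''⟩ := ihres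
    obtain ⟨α, hα, rfl⟩ := A.exists_eq_ker H₀ h₀
    have hdim := Module.Dual.finrank_ker_add_one_of_ne_zero hα
    set M := (π.parts.erase B).val.map Finset.card with hM
    have hM'' : π''.parts.val.map Finset.card = M := by
      rw [hπ'']
      exact card_image_parts π hB hbij.injOn
    have hMcard : Multiset.card M = π''.parts.card := by
      rw [← hM'', Multiset.card_map, Finset.card_val]
    have hr : π.parts.card = π''.parts.card + 1 := by
      rw [← hMcard, hM, Multiset.card_map, Finset.card_val, Finset.card_erase_add_one hB]
    have hMA : π.parts.val.map Finset.card = B.card ::ₘ M := by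
      rw [hM, Finset.erase_val, ← Multiset.map_cons, Multiset.cons_erase hB]
    -- Counting exponents of `A''` bounds its number of blocks by `dim H₀`, so the truncated
    -- subtractions below are genuine.
    have hdim'' := hexp''.card_eq
    rw [hM''] at hexp'' hdim''
    rw [Multiset.card_add, Multiset.card_replicate, hMcard] at hdim''
    have hBpos : 0 < B.card := Finset.card_pos.mpr ⟨_, hH₀⟩
    have hdel' : (A.deletion (LinearMap.ker α)).HasExponents ((B.card - 1) ::ₘ
        (Multiset.replicate (Module.finrank K (LinearMap.ker α) - π''.parts.card) 0 + M)) := by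
      convert! hexp' using 1
      have h1 := avoid_singleton_parts_card π hB hH₀ hMA
      have h2 := congrArg Multiset.card h1
      rw [Multiset.card_map, Finset.card_val] at h2
      refine Eq.symm (Eq.trans (congrArg₂ (fun r N => Multiset.replicate
        (Module.finrank K V - r) 0 + N) h2 h1) ?_)
      -- If `B = {H₀}`, the partition of `A'` has one block fewer, and the exponent `B.card - 1 = 0`
      -- is the additional zero in the padding. Otherwise it is the size of the shrunken block.
      split_ifs with hB1
      · rw [hMcard, hB1, Nat.sub_self, ← Multiset.cons_add, ← Multiset.replicate_succ]
        congr 2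
        omega
      · rw [Multiset.card_cons, hMcard, Multiset.add_cons]
        congr 3
        omega
    -- Bijectivity of the restriction map on `A \ B` is what identifies Terao's degree `|A'| -
    -- |A''|` with `|B| - 1`.
    have hcard : B.card - 1 + (A.restriction _ h₀).hyperplanes.card =
        (A.deletion (LinearMap.ker α)).hyperplanes.card := by
      have hBA : B ⊆ A.hyperplanes := π.le hB
      have h1 : (A.hyperplanes \ B).card = (A.restriction _ h₀).hyperplanes.card :=
        Finset.card_nbij _ hbij.mapsTo hbij.injOn hbij.surjOn
      have h2 : (A.deletion (LinearMap.ker α)).hyperplanes.card = A.hyperplanes.card - 1 := by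
        rw [deletion, Finset.card_sdiff_of_subset (Finset.singleton_subset_iff.mpr h₀),
          Finset.card_singleton]
      have h3 := Finset.card_sdiff_of_subset hBA
      have h4 := Finset.card_le_card hBA
      omega
    refine ⟨?_, ?_, ?_⟩
    · rw [rank_eq_rank_restriction_add_one A h₀ hdim, hrank'', hr]
    · exact .add A _ h₀ hfree' hfree'' _ _ hdel' hexp'' (Multiset.le_cons_self _ _)
    · have := hdel'.addition hα h₀ hcard hexp''
      rw [Nat.sub_add_cancel hBpos] at this
      rw [hMA, Multiset.add_cons, hr, ← hdim, Nat.add_sub_add_right]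
      exact this

end Arrangement

theorem mainTheorem4 {K : Type*} [Field K] {V : Type*} [AddCommGroup V] [Module K V]
    [FiniteDimensional K V] (A : Arrangement K V) (π : Finpartition A.hyperplanes)
    (hπ : A.InductiveFactorization π) :
    A.rank = π.parts.card ∧ A.InductivelyFree ∧
      ∀ E : Multiset ℕ, A.HasExponents E ↔
        E = Multiset.replicate (Module.finrank K V - π.parts.card) 0 +
          π.parts.val.map Finset.card := by
  obtain ⟨h1, h2, h3⟩ := hπ.rank_and_exponents
  exact ⟨h1, h2, fun E => ⟨fun hE => hE.unique h3, fun hE => hE ▸ h3⟩⟩
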